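/- Let $P_n$ ($n\ge 0$) be the Legendre polynomials, $P_{-1}:=0$, and let $C_n^{(\lambda)}$ be the ultraspherical polynomials, for all real $\lambda$ given by $C_0^{(\lambda)}=1$, $C_1^{(\lambda)}(x)=2\lambda x$, $(n+2)C_{n+2}^{(\lambda)}(x)=2(n+1+\lambda)xC_{n+1}^{(\lambda)}(x)-(n+2\lambda)C_n^{(\lambda)}(x)$. Let $\log$ be the principal branch of the logarithm (with $\arg\in(-\pi,\pi]$ and $0\log 0:=0$), and let $\log_- z:=\log|z|-\mathrm i\pi$ if $z$ is real and negative, $\log_- z:=\log z$ otherwise. Let $\Omega=\{x+\mathrm iy:-1\le x,y\le 1\}$ and, for $z\in\mathbb C$ and integers $k,j\ge -1$, $$L_{kj}(z)=\int_{-1}^1\!\int_{-1}^1\log\bigl(z-(s+\mathrm it)\bigr)P_k(s)P_j(t)\,ds\,dt,$$ $$L_k(z)=\int_{-1}^1\log(z-t)P_k(t)\,dt,\qquad M_k(z)=\int_{-1}^1\log(z-\mathrm it)P_k(t)\,dt,$$ so that $L_{-1,j}=L_{k,-1}=L_{-1}=M_{-1}=0$. For $z=x+\mathrm iy$ and $k\ge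 0$ put $$\lambda_k(z)=\begin{cases}(z-1)\log(z-1)+(z+1)\log(z+1)&k=0\\-2/3&k=1\\0&k\ge2,\end{cases}$$ $$\mu_k(z)=\begin{cases}(z-\mathrm i)\log(z-\mathrm i)+(z+\mathrm i)\log_-(z+\mathrm i)&k=0\\-2\mathrm i/3&k=1\\0&k\ge2\end{cases}\;-\;\begin{cases}2\mathrm i\pi x\,C_{k+1}^{(-1/2)}(y)&x<0\text{ and }-1<y<1\\0&\text{otherwise.}\end{cases}$$ Then all these integrals converge absolutely, and for all integers $k,j\ge0$ and every $z=x+\mathrm iy\in\mathbb C$, $$zL_{kj}=\frac{k-1}{2k+1}L_{k-1,j}+\frac{k+2}{2k+1}L_{k+1,j}+\mathrm i\Bigl(\frac{j}{2j+1}L_{k,j-1}+\frac{j+1}{2j+1}L_{k,j+1}\Bigr)+F^{(1)}_{kj}(z),$$ $$zL_{kj}=\frac{k}{2k+1}L_{k-1,j}+\frac{k+1}{2k+1}L_{k+1,j}+\mathrm i\Bigl(\frac{j-1}{2j+1}L_{k,j-1}+\frac{j+2}{2j+1}L_{k,j+1}\Bigr)+F^{(2)}_{kj}(z),$$ where all $L$'s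 are evaluated at $z$, $$F^{(1)}_{0j}(z)=\mathrm i\,\frac{M_{j+1}(z-1)+M_{j+1}(z+1)-M_{j-1}(z-1)-M_{j-1}(z+1)}{2j+1}+\mu_j(z-1)+\mu_j(z+1),$$ $F^{(1)}_{10}(z)=-4/3$, and $F^{(1)}_{kj}(z)=0$ for $k\ne0$, $(k,j)\ne(1,0)$; $$F^{(2)}_{k0}(z)=\frac{L_{k+1}(z-\mathrm i)+L_{k+1}(z+\mathrm i)-L_{k-1}(z-\mathrm i)-L_{k-1}(z+\mathrm i)}{2k+1}+\lambda_k(z-\mathrm i)+\lambda_k(z+\mathrm i)+\beta_{k0}(z),$$ $F^{(2)}_{01}(z)=-4\mathrm i/3+\beta_{01}(z)$, and $F^{(2)}_{kj}(z)=\beta_{kj}(z)$ for $j\ne0$, $(k,j)\ne(0,1)$; and $$\beta_{kj}(z)=2\mathrm i\pi\,C_{j+1}^{(-1/2)}(y)\begin{cases}C_{k+2}^{(-3/2)}(x)/3-\delta_{k0}x+\delta_{k1}/3&z\in\Omega\text{ and }y\ne1\\-2x\,\delta_{k0}+2\delta_{k1}/3&x<-1\text{ and }-1\le y<1\\0&\text{otherwise.}\end{cases}$$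 -/

import Mathlib

namespace NewtonianLog

noncomputable section

open Complex

/-- The Legendre polynomials `P_n`, `n ≥ 0`, as real functions, through
`P_0 = 1`, `P_1 = x`, `(n + 2) P_{n+2} = (2n + 3) x P_{n+1} - (n + 1) P_n`. -/
def legendreNat : ℕ → ℝ → ℝ
  | 0, _ => 1
  | 1, x => x
  | n + 2, x =>
      ((2 * (n : ℝ) + 3) * x * legendreNat (n + 1) x - ((n : ℝ) + 1) * legendreNat n x)
        / ((n : ℝ) + 2)

/-- The Legendre polynomials with an integer index, where `P_n = 0` for `n < 0`. -/
def legendreP (n : ℤ) (x : ℝ) : ℝ :=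
  if n < 0 then 0 else legendreNat n.toNat x

/-- The ultraspherical (Gegenbauer) polynomials `C_n^{(lam)}`, for every real parameter `lam`, in
the standard normalisation: `C_0 = 1`, `C_1 = 2 lam x`,
`(n + 2) C_{n+2} = 2 (n + 1 + lam) x C_{n+1} - (n + 2 lam) C_n`. -/
def ultraspherical (lam : ℝ) : ℕ → ℝ → ℝ
  | 0, _ => 1
  | 1, x => 2 * lam * x
  | n + 2, x =>
      (2 * ((n : ℝ) + 1 + lam) * x * ultraspherical lam (n + 1) x
        - ((n : ℝ) + 2 * lam) * ultraspherical lam n x) / ((n : ℝ) + 2)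

/-- The square `Ω = {(x, y) : -1 ≤ x, y ≤ 1}`. -/
def square : Set (ℝ × ℝ) := Set.Icc (-1) 1 ×ˢ Set.Icc (-1) 1

/-- The integrand `log (z - t) P_k(t)` of `L_k(z)`. -/
def logKernel (k : ℤ) (z : ℂ) (t : ℝ) : ℂ := log (z - t) * (legendreP k t : ℂ)

/-- `L_k(z) = ∫_{-1}^1 log (z - t) P_k(t) dt`, with the principal branch of the logarithm. -/
def logL (k : ℤ) (z : ℂ) : ℂ := ∫ t in (-1 : ℝ)..1, logKernel k z t

/-- The integrand `log (z - i t) P_k(t)` of `M_k(z)`. -/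
def logKernelI (k : ℤ) (z : ℂ) (t : ℝ) : ℂ := log (z - I * t) * (legendreP k t : ℂ)

/-- `M_k(z) = ∫_{-1}^1 log (z - i t) P_k(t) dt`. -/
def logM (k : ℤ) (z : ℂ) : ℂ := ∫ t in (-1 : ℝ)..1, logKernelI k z t

/-- The integrand `log (z - (s + i t)) P_k(s) P_j(t)` of `L_{kj}(z)`, at `p = (s, t)`. -/
def logKernel₂ (k j : ℤ) (z : ℂ) (p : ℝ × ℝ) : ℂ :=
  log (z - (p.1 + I * p.2)) * ((legendreP k p.1 * legendreP j p.2 : ℝ) : ℂ)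

/-- `L_{kj}(z) = ∬_Ω log (z - (s + i t)) P_k(s) P_j(t) ds dt`. In particular
`L_{-1,j} = L_{k,-1} = 0`. -/
def logL₂ (k j : ℤ) (z : ℂ) : ℂ := ∫ p in square, logKernel₂ k j z p

/-- `λ_k(z)`. -/
def lambdaTerm (k : ℕ) (z : ℂ) : ℂ :=
  if k = 0 then (z - 1) * log (z - 1) + (z + 1) * log (z + 1)
  else if k = 1 then -2 / 3
  else 0

/-- The logarithm `log_-` that takes the other limit along its branch cut. -/
def logMinus (z : ℂ) : ℂ :=
  if z.im = 0 ∧ z.re < 0 then (Real.log ‖z‖ : ℂ) - I * (Real.pi : ℂ) else log z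

/-- `μ_k(z)`. -/
def muTerm (k : ℕ) (z : ℂ) : ℂ :=
  (if k = 0 then (z - I) * log (z - I) + (z + I) * logMinus (z + I)
    else if k = 1 then -2 * I / 3
    else 0)
  - (if z.re < 0 ∧ -1 < z.im ∧ z.im < 1 then
      2 * I * (Real.pi : ℂ) * (z.re : ℂ) * (ultraspherical (-1 / 2) (k + 1) z.im : ℂ)
    else 0)

open Classical in
/-- The factor of `β_{kj}(z)` that is given by cases; `z = x + i y` with `x = z.re`, `y = z.im`. -/
def betaFactor (k : ℕ) (z : ℂ) : ℝ :=
  if (z.re, z.im) ∈ square ∧ z.im ≠ 1 then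
    ultraspherical (-3 / 2) (k + 2) z.re / 3
      - (if k = 0 then z.re else 0) + (if k = 1 then 1 / 3 else 0)
  else if z.re < -1 ∧ -1 ≤ z.im ∧ z.im < 1 then
    (if k = 0 then -2 * z.re else 0) + (if k = 1 then 2 / 3 else 0)
  else 0

/-- `β_{kj}(z)`. -/
def betaTerm (k j : ℕ) (z : ℂ) : ℂ :=
  2 * I * (Real.pi : ℂ) * (ultraspherical (-1 / 2) (j + 1) z.im : ℂ) * (betaFactor k z : ℂ)

/-- The inhomogeneity `F_{kj}^{(1)}(z)` of the first recurrence. -/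
def inhomOne (k j : ℕ) (z : ℂ) : ℂ :=
  if k = 0 then
    I * (logM ((j : ℤ) + 1) (z - 1) + logM ((j : ℤ) + 1) (z + 1)
        - logM ((j : ℤ) - 1) (z - 1) - logM ((j : ℤ) - 1) (z + 1)) / (2 * (j : ℂ) + 1)
      + muTerm j (z - 1) + muTerm j (z + 1)
  else if k = 1 ∧ j = 0 then -4 / 3
  else 0

/-- The inhomogeneity `F_{kj}^{(2)}(z)` of the second recurrence. -/
def inhomTwo (k j : ℕ) (z : ℂ) : ℂ :=
  if j = 0 then
    (logL ((k : ℤ) + 1) (z - I) + logL ((k : ℤ) + 1) (z + I)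
        - logL ((k : ℤ) - 1) (z - I) - logL ((k : ℤ) - 1) (z + I)) / (2 * (k : ℂ) + 1)
      + lambdaTerm k (z - I) + lambdaTerm k (z + I) + betaTerm k 0 z
  else if k = 0 ∧ j = 1 then -4 * I / 3 + betaTerm 0 1 z
  else betaTerm k j z

end

end NewtonianLog

/-!
The idea is to multiply the integrand `log w`, `w = z - (s + i t)`, by `z = w + s + i t`. The
three-term recurrence of the Legendre polynomials turns `s P_k(s)` and `t P_j(t)` into neighbouring
`L`'s, so everything rests on the moments of `w log w`. Since `C_{k+1}^{(-1/2)}`, up to sign an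
antiderivative of `P_k`, is a multiple of `P_{k-1} - P_{k+1}`, integrating `w log w` by parts in one
variable gives back moments of `log w`: integration in `s` yields the first recurrence, integration
in `t` the second.

The endpoints of the segments contribute one-dimensional moments of `w log w`, to which the same
integration by parts applies. A horizontal segment never crosses the branch cut of the logarithm. A
vertical segment centred at `x + i y` with `x < 0` and `-1 ≤ y < 1` does, and the jump of `w log w`
there produces the corrections in `μ_j` and, once integrated over `s`, the terms `β_{kj}`.
-/

namespace NewtonianLog

open Complex MeasureTheory Set
open scoped ComplexConjugate

/-! ### Ultraspherical polynomials -/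

section Ultraspherical

variable (lam : ℝ) (n : ℕ) (x : ℝ)

lemma ultraspherical_add_two :
    ((n : ℝ) + 2) * ultraspherical lam (n + 2) x =
      2 * ((n : ℝ) + 1 + lam) * x * ultraspherical lam (n + 1) x
        - ((n : ℝ) + 2 * lam) * ultraspherical lam n x := by
  rw [ultraspherical, mul_div_cancel₀ _ (by positivity)]

lemma ultraspherical_one_eq_ascPochhammer_div_factorial :
    ultraspherical lam n 1 = (ascPochhammer ℝ n).eval (2 * lam) / n.factorial := by
  induction n using Nat.twoStepInduction with
  | zero => simp [ultraspherical]
  | one => simp [ultraspherical]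
  | more n ih₀ ih₁ =>
    rw [ultraspherical, ih₀, ih₁, ascPochhammer_succ_eval (n + 1), ascPochhammer_succ_eval n,
      Nat.factorial_succ (n + 1), Nat.factorial_succ n]
    push_cast
    field_simp
    ring

lemma ultraspherical_neg :
    ultraspherical lam n (-x) = (-1) ^ n * ultraspherical lam n x := by
  induction n using Nat.twoStepInduction with
  | zero => simp [ultraspherical]
  | one => simp [ultraspherical]
  | more n ih₀ ih₁ =>
    rw [ultraspherical, ultraspherical, ih₀, ih₁]
    ring

/-- The two relations have to be proved together: the induction step for either of them uses
both. -/
lemma ultraspherical_contiguous :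
    ((n : ℝ) + 2) * ultraspherical lam (n + 2) x =
        2 * lam * (x * ultraspherical (lam + 1) (n + 1) x - ultraspherical (lam + 1) n x) ∧
      ((n : ℝ) + 1 + 2 * lam) * ultraspherical lam (n + 1) x =
        2 * lam * (ultraspherical (lam + 1) (n + 1) x - x * ultraspherical (lam + 1) n x) := by
  induction n with
  | zero =>
    constructor
    · rw [ultraspherical_add_two]
      simp only [ultraspherical]
      push_cast
      ring
    · simp only [ultraspherical]
      push_cast
      ring
  | succ n ih =>
    obtain ⟨raise_two, raise_one⟩ := ih
    have raise_one_succ : ((n : ℝ) + 2 + 2 * lam) * ultraspherical lam (n + 2) x =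
        2 * lam * (ultraspherical (lam + 1) (n + 2) x
          - x * ultraspherical (lam + 1) (n + 1) x) := by
      apply mul_left_cancel₀ (show (n : ℝ) + 2 ≠ 0 by positivity)
      linear_combination ((n : ℝ) + 2 + 2 * lam) * raise_two
        - 2 * lam * ultraspherical_add_two (lam + 1) n x
    have three_term := ultraspherical_add_two lam (n + 1) x
    push_cast at three_term ⊢
    constructor
    · linear_combination three_term + x * raise_two - raise_one + x * raise_one_succ
    · linear_combination raise_one_succ

lemma ultraspherical_eq_sub_ultraspherical_add_one :
    ((n : ℝ) + 2 + lam) * ultraspherical lam (n + 2) x =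
      lam * (ultraspherical (lam + 1) (n + 2) x - ultraspherical (lam + 1) n x) := by
  have raise_two := (ultraspherical_contiguous lam n x).1
  have raise_one := (ultraspherical_contiguous lam (n + 1) x).2
  push_cast at raise_one
  linear_combination (raise_two + raise_one) / 2

variable {lam n x} in
lemma hasDerivAt_ultraspherical_add_two {d₀ d₁ : ℝ}
    (h₀ : HasDerivAt (ultraspherical lam n) d₀ x)
    (h₁ : HasDerivAt (ultraspherical lam (n + 1)) d₁ x) :
    HasDerivAt (ultraspherical lam (n + 2))
      ((2 * ((n : ℝ) + 1 + lam) * (ultraspherical lam (n + 1) x + x * d₁)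
        - ((n : ℝ) + 2 * lam) * d₀) / ((n : ℝ) + 2)) x := by
  have h := ((((hasDerivAt_id x).const_mul (2 * ((n : ℝ) + 1 + lam))).mul h₁).sub
    (h₀.const_mul ((n : ℝ) + 2 * lam))).div_const ((n : ℝ) + 2)
  refine (h.congr_deriv ?_).congr_of_eventuallyEq (.of_forall fun _ ↦ rfl)
  simp only [id]
  ring

lemma hasDerivAt_ultraspherical :
    HasDerivAt (ultraspherical lam (n + 1)) (2 * lam * ultraspherical (lam + 1) n x) x := by
  have h₁ : HasDerivAt (ultraspherical lam 1) (2 * lam) x := by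
    simpa [ultraspherical] using (hasDerivAt_id x).const_mul (2 * lam)
  induction n using Nat.twoStepInduction with
  | zero => simpa [ultraspherical] using h₁
  | one =>
    have h₀ : HasDerivAt (ultraspherical lam 0) 0 x := hasDerivAt_const x 1
    refine (hasDerivAt_ultraspherical_add_two h₀ h₁).congr_deriv ?_
    simp only [ultraspherical]
    push_cast
    ring
  | more n ih₀ ih₁ =>
    refine (hasDerivAt_ultraspherical_add_two ih₀ ih₁).congr_deriv ?_
    have three_term := ultraspherical_add_two (lam + 1) n x
    have lower := ultraspherical_eq_sub_ultraspherical_add_one lam n x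
    rw [div_eq_iff (by positivity)]
    push_cast
    linear_combination 2 * lower - 2 * lam * three_term

@[fun_prop]
lemma continuous_ultraspherical : Continuous (ultraspherical lam n) := by
  cases n with
  | zero => exact continuous_const
  | succ n =>
    exact continuous_iff_continuousAt.2 fun x ↦ (hasDerivAt_ultraspherical lam n x).continuousAt

end Ultraspherical

/-! ### Legendre polynomials and their antiderivatives -/

lemma legendreNat_eq_ultraspherical (n : ℕ) (x : ℝ) :
    legendreNat n x = ultraspherical (1 / 2) n x := by
  induction n using Nat.twoStepInduction with
  | zero => rfl
  | one => simp [legendreNat, ultraspherical]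
  | more n ih₀ ih₁ =>
    rw [legendreNat, ultraspherical, ih₀, ih₁]
    ring

lemma legendreP_natCast (n : ℕ) (x : ℝ) : legendreP n x = ultraspherical (1 / 2) n x := by
  simp [legendreP, legendreNat_eq_ultraspherical]

lemma legendreP_natCast_add_one (n : ℕ) (x : ℝ) :
    legendreP ((n : ℤ) + 1) x = ultraspherical (1 / 2) (n + 1) x :=
  mod_cast legendreP_natCast (n + 1) x

lemma natCast_succ_sub_one (n : ℕ) : ((n + 1 : ℕ) : ℤ) - 1 = n := by
  push_cast
  ring

@[fun_prop]
lemma continuous_legendreP (k : ℤ) : Continuous (legendreP k) := by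
  unfold legendreP
  split_ifs
  · exact continuous_const
  · simp only [legendreNat_eq_ultraspherical]
    fun_prop

lemma mul_legendreP (k : ℕ) (x : ℝ) :
    x * legendreP k x = (k : ℝ) / (2 * k + 1) * legendreP ((k : ℤ) - 1) x
      + ((k : ℝ) + 1) / (2 * k + 1) * legendreP ((k : ℤ) + 1) x := by
  cases k with
  | zero => simp [legendreP, legendreNat]
  | succ k =>
    have three_term := ultraspherical_add_two (1 / 2) k x
    rw [legendreP_natCast_add_one, legendreP_natCast, natCast_succ_sub_one, legendreP_natCast]
    push_cast
    field_simp
    linear_combination -three_term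

/-- The antiderivative `-C_{k+1}^{(-1/2)}` of the Legendre polynomial `P_k`; for `k ≥ 1` it is the
one that vanishes at `±1`. -/
noncomputable def legendrePrimitive (k : ℕ) (x : ℝ) : ℝ := -ultraspherical (-1 / 2) (k + 1) x

lemma hasDerivAt_legendrePrimitive (k : ℕ) (x : ℝ) :
    HasDerivAt (legendrePrimitive k) (legendreP k x) x := by
  refine (hasDerivAt_ultraspherical (-1 / 2) k x).neg.congr_deriv ?_
  rw [legendreP_natCast, show (-1 / 2 : ℝ) + 1 = 1 / 2 by norm_num]
  ring

@[fun_prop]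
lemma continuous_legendrePrimitive (k : ℕ) : Continuous (legendrePrimitive k) :=
  (continuous_ultraspherical _ _).neg

lemma legendrePrimitive_eq_sub (k : ℕ) (x : ℝ) :
    legendrePrimitive k x =
      (legendreP ((k : ℤ) + 1) x - legendreP ((k : ℤ) - 1) x) / (2 * k + 1) := by
  rw [eq_div_iff (by positivity), legendrePrimitive, legendreP_natCast_add_one]
  cases k with
  | zero =>
    simp [legendreP, ultraspherical]
    ring
  | succ k =>
    have lower := ultraspherical_eq_sub_ultraspherical_add_one (-1 / 2) k x
    rw [show (-1 / 2 : ℝ) + 1 = 1 / 2 by norm_num] at lower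
    rw [natCast_succ_sub_one, legendreP_natCast]
    push_cast
    linear_combination -2 * lower

lemma ultraspherical_neg_half_one (k : ℕ) :
    ultraspherical (-1 / 2) (k + 1) 1 = if k = 0 then -1 else 0 := by
  rw [ultraspherical_one_eq_ascPochhammer_div_factorial]
  rcases k with _ | k
  · norm_num
  · rw [show (2 * (-1 / 2) : ℝ) = -((1 : ℕ) : ℝ) by norm_num,
      ascPochhammer_eval_neg_coe_nat_of_lt (by lia)]
    simp

lemma legendrePrimitive_one (k : ℕ) : legendrePrimitive k 1 = if k = 0 then 1 else 0 := by
  rw [legendrePrimitive, ultraspherical_neg_half_one]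
  split_ifs <;> simp

lemma legendrePrimitive_neg_one (k : ℕ) : legendrePrimitive k (-1) = if k = 0 then -1 else 0 := by
  rw [legendrePrimitive, ultraspherical_neg, ultraspherical_neg_half_one]
  split_ifs with hk <;> simp [hk]

/-- The antiderivative `C_{k+2}^{(-3/2)} / 3` of `legendrePrimitive k`. -/
noncomputable def legendrePrimitive₂ (k : ℕ) (x : ℝ) : ℝ := ultraspherical (-3 / 2) (k + 2) x / 3

lemma hasDerivAt_legendrePrimitive₂ (k : ℕ) (x : ℝ) :
    HasDerivAt (legendrePrimitive₂ k) (legendrePrimitive k x) x := by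
  refine ((hasDerivAt_ultraspherical (-3 / 2) (k + 1) x).div_const 3).congr_deriv ?_
  rw [legendrePrimitive, show (-3 / 2 : ℝ) + 1 = -1 / 2 by norm_num]
  ring

lemma legendrePrimitive₂_one (k : ℕ) :
    legendrePrimitive₂ k 1 = if k = 0 then 1 else if k = 1 then -1 / 3 else 0 := by
  rw [legendrePrimitive₂, ultraspherical_one_eq_ascPochhammer_div_factorial]
  match k with
  | 0 | 1 => norm_num [ascPochhammer_succ_eval, Nat.factorial]
  | k + 2 =>
    rw [show (2 * (-3 / 2) : ℝ) = -((3 : ℕ) : ℝ) by norm_num,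
      ascPochhammer_eval_neg_coe_nat_of_lt (by lia)]
    simp

lemma legendrePrimitive₂_neg_one (k : ℕ) :
    legendrePrimitive₂ k (-1) = (-1) ^ k * legendrePrimitive₂ k 1 := by
  rw [legendrePrimitive₂, legendrePrimitive₂, ultraspherical_neg]
  ring

lemma integral_legendreP (k : ℕ) :
    ∫ s in (-1 : ℝ)..1, legendreP k s = if k = 0 then 2 else 0 := by
  rw [intervalIntegral.integral_eq_sub_of_hasDerivAt
    (fun x _ ↦ hasDerivAt_legendrePrimitive k x)
    ((continuous_legendreP k).intervalIntegrable _ _),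
    legendrePrimitive_one, legendrePrimitive_neg_one]
  split_ifs <;> norm_num

lemma integral_legendrePrimitive (k : ℕ) :
    ∫ s in (-1 : ℝ)..1, legendrePrimitive k s = if k = 1 then -2 / 3 else 0 := by
  rw [intervalIntegral.integral_eq_sub_of_hasDerivAt
    (fun x _ ↦ hasDerivAt_legendrePrimitive₂ k x)
    ((continuous_legendrePrimitive k).intervalIntegrable _ _),
    legendrePrimitive₂_neg_one, legendrePrimitive₂_one]
  rcases k with _ | _ | k <;> norm_num

lemma integral_sub_mul_legendreP (k : ℕ) (x a b : ℝ) :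
    ∫ s in a..b, (s - x) * legendreP k s =
      ((b - x) * legendrePrimitive k b - legendrePrimitive₂ k b)
        - ((a - x) * legendrePrimitive k a - legendrePrimitive₂ k a) := by
  refine intervalIntegral.integral_eq_sub_of_hasDerivAt
    (f := fun s ↦ (s - x) * legendrePrimitive k s - legendrePrimitive₂ k s) (fun s _ ↦ ?_)
    (Continuous.intervalIntegrable (by fun_prop) _ _)
  refine ((((hasDerivAt_id s).sub_const x).mul (hasDerivAt_legendrePrimitive k s)).sub
    (hasDerivAt_legendrePrimitive₂ k s)).congr_deriv ?_
  simp only [id]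
  ring

lemma integral_sub_mul_legendreP_neg_one_one (k : ℕ) (x : ℝ) :
    ∫ s in (-1 : ℝ)..1, (s - x) * legendreP k s =
      (if k = 0 then -2 * x else 0) + (if k = 1 then 2 / 3 else 0) := by
  rw [integral_sub_mul_legendreP, legendrePrimitive_one, legendrePrimitive_neg_one,
    legendrePrimitive₂_neg_one, legendrePrimitive₂_one]
  rcases k with _ | _ | k <;> norm_num
  ring

lemma integral_sub_mul_legendreP_self_one (k : ℕ) (x : ℝ) :
    ∫ s in x..1, (s - x) * legendreP k s =
      ultraspherical (-3 / 2) (k + 2) x / 3 - (if k = 0 then x else 0)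
        + (if k = 1 then 1 / 3 else 0) := by
  rw [integral_sub_mul_legendreP, legendrePrimitive_one, legendrePrimitive₂_one,
    legendrePrimitive₂]
  rcases k with _ | _ | k <;> norm_num <;> ring

/-! ### The logarithm along a segment -/

lemma norm_log_le_abs_log_norm_add_pi (w : ℂ) : ‖log w‖ ≤ |Real.log ‖w‖| + Real.pi := by
  have h := norm_le_abs_re_add_abs_im (log w)
  rw [log_re, log_im] at h
  linarith [abs_arg_le_pi w]

lemma intervalIntegrable_log_sub_mul (ζ c : ℂ) (a b : ℝ) :
    IntervalIntegrable (fun τ : ℝ ↦ log (ζ - c * τ)) volume a b := by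
  have log_norm : IntervalIntegrable (fun τ : ℝ ↦ Real.log ‖ζ - c * τ‖) volume a b :=
    MeromorphicOn.intervalIntegrable_log_norm fun τ _ ↦
      (analyticAt_const.sub (analyticAt_const.mul (ofRealCLM.analyticAt τ))).meromorphicAt
  have majorant := log_norm.abs.add (intervalIntegrable_const (c := Real.pi))
  have log_meas : Measurable fun τ : ℝ ↦ log (ζ - c * τ) := by fun_prop
  refine majorant.mono_fun log_meas.aestronglyMeasurable (.of_forall fun τ ↦ ?_)
  exact (norm_log_le_abs_log_norm_add_pi _).trans (le_abs_self _)

/-- The function `w ↦ w log w`, principal branch, with value `0` at `w = 0`. It is what multiplying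
the logarithmic kernels by their own argument produces. -/
noncomputable def mulLog (w : ℂ) : ℂ := w * log w

/-- The function `w ↦ w log_- w`, with value `0` at `w = 0`. -/
noncomputable def mulLogMinus (w : ℂ) : ℂ := w * logMinus w

lemma continuousAt_mulLog_zero : ContinuousAt mulLog 0 := by
  have majorant : Continuous fun w : ℂ ↦ |‖w‖ * Real.log ‖w‖| + Real.pi * ‖w‖ :=
    (Real.continuous_mul_log.comp continuous_norm).abs.add (by fun_prop)
  have majorant_tendsto : Filter.Tendsto (fun w : ℂ ↦ |‖w‖ * Real.log ‖w‖| + Real.pi * ‖w‖)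
      (nhds 0) (nhds 0) := by
    simpa using majorant.tendsto 0
  rw [ContinuousAt, mulLog, zero_mul]
  refine squeeze_zero_norm (fun w ↦ ?_) majorant_tendsto
  calc ‖mulLog w‖ = ‖w‖ * ‖log w‖ := norm_mul _ _
    _ ≤ ‖w‖ * (|Real.log ‖w‖| + Real.pi) := by
      exact mul_le_mul_of_nonneg_left (norm_log_le_abs_log_norm_add_pi w) (norm_nonneg w)
    _ = |‖w‖ * Real.log ‖w‖| + Real.pi * ‖w‖ := by
      rw [abs_mul, abs_norm]
      ring

lemma hasDerivAt_mulLog {w : ℂ} (hw : w ∈ slitPlane) : HasDerivAt mulLog (log w + 1) w := by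
  refine ((hasDerivAt_id w).mul (hasDerivAt_log hw)).congr_deriv ?_
  rw [id, one_mul, mul_inv_cancel₀ (slitPlane_ne_zero hw)]

lemma mem_slitPlane_of_re_nonneg {w : ℂ} (hw : 0 ≤ w.re) (h0 : w ≠ 0) : w ∈ slitPlane := by
  rcases hw.lt_or_eq with hre | hre
  · exact .inl hre
  · exact .inr fun him ↦ h0 (Complex.ext hre.symm him)

lemma continuousAt_mulLog_of_re_nonneg {w : ℂ} (hw : 0 ≤ w.re) : ContinuousAt mulLog w := by
  by_cases h0 : w = 0
  · rw [h0]
    exact continuousAt_mulLog_zero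
  · exact (hasDerivAt_mulLog (mem_slitPlane_of_re_nonneg hw h0)).continuousAt

lemma log_eq_log_neg_I_mul_add {w : ℂ} (hw : 0 ≤ w.im) (h0 : w ≠ 0) :
    log w = log (-I * w) + I * (Real.pi / 2) := by
  have h_nonneg := arg_nonneg_iff.2 hw
  have h_le := arg_le_pi w
  rw [log_mul (neg_ne_zero.2 I_ne_zero) h0, log_neg_I]
  · ring
  · rw [arg_neg_I]
    constructor <;> linarith [Real.pi_pos]

/-- Rotating by `-I` moves the branch cut off the closed upper half-plane. -/
lemma mulLog_eq_mulLog_neg_I_mul_add {w : ℂ} (hw : 0 ≤ w.im) :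
    mulLog w = I * mulLog (-I * w) + I * (Real.pi / 2) * w := by
  by_cases h0 : w = 0
  · simp [h0, mulLog]
  · rw [mulLog, mulLog, log_eq_log_neg_I_mul_add hw h0]
    linear_combination (w * log (-I * w)) * I_mul_I

lemma logMinus_eq_conj_log_conj (w : ℂ) : logMinus w = conj (log (conj w)) := by
  rw [logMinus, log_conj_eq_ite]
  by_cases h : w.re < 0 ∧ w.im = 0
  · rw [if_pos h.symm, if_pos (arg_eq_pi_iff.2 h), log, arg_eq_pi_iff.2 h, map_add, map_mul,
      conj_I, conj_ofReal, conj_ofReal]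
    ring
  · rw [if_neg (mt And.symm h), if_neg (mt arg_eq_pi_iff.1 h), conj_conj]

lemma mulLogMinus_eq_conj_mulLog_conj (w : ℂ) : mulLogMinus w = conj (mulLog (conj w)) := by
  rw [mulLogMinus, mulLog, logMinus_eq_conj_log_conj, map_mul, conj_conj]

lemma logMinus_of_im_ne_zero {w : ℂ} (hw : w.im ≠ 0) : logMinus w = log w := by
  simp [logMinus, hw]

lemma mulLogMinus_of_im_ne_zero {w : ℂ} (hw : w.im ≠ 0) : mulLogMinus w = mulLog w := by
  rw [mulLogMinus, mulLog, logMinus_of_im_ne_zero hw]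

lemma mulLogMinus_of_im_eq_zero {w : ℂ} (hw : w.im = 0) :
    mulLogMinus w = mulLog w + 2 * I * Real.pi * (max (-w.re) 0 : ℝ) := by
  rw [mulLogMinus, mulLog, logMinus]
  rcases lt_or_ge w.re 0 with hre | hre
  · have hw_re : (w.re : ℂ) = w := Complex.ext (by simp) (by simp [hw])
    rw [if_pos ⟨hw, hre⟩, max_eq_left (by linarith), log, arg_eq_pi_iff.2 ⟨hre, hw⟩, ofReal_neg,
      hw_re]
    ring
  · rw [if_neg (by simp [hre.not_gt]), max_eq_right (by linarith)]
    simp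

/-! ### Integration by parts along a segment -/

lemma integral_mul_deriv_off_countable {u u' v v' : ℝ → ℂ} {a b : ℝ} (hab : a ≤ b) {S : Set ℝ}
    (hS : S.Countable) (hu : ContinuousOn u (Icc a b)) (hv : ContinuousOn v (Icc a b))
    (hu' : ∀ τ ∈ Ioo a b \ S, HasDerivAt u (u' τ) τ)
    (hv' : ∀ τ ∈ Ioo a b \ S, HasDerivAt v (v' τ) τ)
    (hu_int : IntervalIntegrable u' volume a b) (hv_int : IntervalIntegrable v' volume a b) :
    ∫ τ in a..b, u τ * v' τ = u b * v b - u a * v a - ∫ τ in a..b, u' τ * v τ := by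
  have hu'v : IntervalIntegrable (fun τ ↦ u' τ * v τ) volume a b :=
    hu_int.mul_continuousOn (by rwa [uIcc_of_le hab])
  have huv' : IntervalIntegrable (fun τ ↦ u τ * v' τ) volume a b :=
    hv_int.continuousOn_mul (by rwa [uIcc_of_le hab])
  have ftc := integral_eq_of_hasDerivAt_off_countable_of_le (fun τ ↦ u τ * v τ)
    (fun τ ↦ u' τ * v τ + u τ * v' τ) hab hS (hu.mul hv)
    (fun τ hτ ↦ (hu' τ hτ).mul (hv' τ hτ)) (hu'v.add huv')
  rw [intervalIntegral.integral_add hu'v huv'] at ftc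
  linear_combination ftc

section Segment

variable {ζ c : ℂ} {a b : ℝ}

lemma continuousOn_mulLog_sub_mul (him : ∀ τ ∈ Icc a b, 0 ≤ (ζ - c * τ).im) :
    ContinuousOn (fun τ : ℝ ↦ mulLog (ζ - c * τ)) (Icc a b) := by
  have rotated : ContinuousOn (fun τ : ℝ ↦ I * mulLog (-I * (ζ - c * τ))
      + I * (Real.pi / 2) * (ζ - c * τ)) (Icc a b) := by
    refine ContinuousOn.add (fun τ hτ ↦ ?_) (by fun_prop)
    have hcont : ContinuousAt mulLog (-I * (ζ - c * τ)) :=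
      continuousAt_mulLog_of_re_nonneg (by simpa using him τ hτ)
    exact (continuousAt_const.mul (hcont.comp (f := fun τ : ℝ ↦ -I * (ζ - c * τ))
      (by fun_prop))).continuousWithinAt
  exact rotated.congr fun τ hτ ↦ mulLog_eq_mulLog_neg_I_mul_add (him τ hτ)

lemma hasDerivAt_mulLog_sub_mul (him : ∀ τ ∈ Icc a b, 0 ≤ (ζ - c * τ).im) {τ : ℝ}
    (hτ : τ ∈ Ioo a b) (h0 : ζ - c * τ ≠ 0) :
    HasDerivAt (fun τ : ℝ ↦ mulLog (ζ - c * τ)) (-c * (log (ζ - c * τ) + 1)) τ := by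
  have him_τ := him τ (Ioo_subset_Icc_self hτ)
  have hslit : -I * (ζ - c * τ) ∈ slitPlane :=
    mem_slitPlane_of_re_nonneg (by simpa using him_τ) (mul_ne_zero (neg_ne_zero.2 I_ne_zero) h0)
  have segment : HasDerivAt (fun τ : ℝ ↦ ζ - c * (τ : ℂ)) (-c) τ := by
    simpa using ((ofRealCLM.hasDerivAt (x := τ)).const_mul c).const_sub ζ
  have rotated := (((hasDerivAt_mulLog hslit).comp_of_eq τ (segment.const_mul (-I)) rfl).const_mul
    I).add (segment.const_mul (I * (Real.pi / 2)))
  refine (rotated.congr_deriv ?_).congr_of_eventuallyEq ?_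
  · rw [log_eq_log_neg_I_mul_add him_τ h0]
    linear_combination -(-c * (log (-I * (ζ - c * τ)) + 1)) * I_mul_I
  · filter_upwards [Ioo_mem_nhds hτ.1 hτ.2] with σ hσ
    exact mulLog_eq_mulLog_neg_I_mul_add (him σ (Ioo_subset_Icc_self hσ))

lemma integral_mulLog_mul_of_im_nonneg (hc : c ≠ 0) (hab : a ≤ b)
    (him : ∀ τ ∈ Icc a b, 0 ≤ (ζ - c * τ).im) {P Q : ℝ → ℝ} (hP : Continuous P)
    (hQ : ∀ τ, HasDerivAt Q (P τ) τ) :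
    ∫ τ in a..b, mulLog (ζ - c * τ) * (P τ : ℂ) =
      mulLog (ζ - c * b) * Q b - mulLog (ζ - c * a) * Q a
        + c * ∫ τ in a..b, (log (ζ - c * τ) + 1) * (Q τ : ℂ) := by
  have hQ_cont : Continuous Q := continuous_iff_continuousAt.2 fun τ ↦ (hQ τ).continuousAt
  have log_int : IntervalIntegrable (fun τ : ℝ ↦ -c * (log (ζ - c * τ) + 1)) volume a b :=
    ((intervalIntegrable_log_sub_mul ζ c a b).add intervalIntegrable_const).const_mul (-c)
  have zero_subsingleton : {τ : ℝ | ζ - c * τ = 0}.Subsingleton := fun σ hσ τ hτ ↦ by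
    simpa [hc] using (sub_eq_zero.1 hσ).symm.trans (sub_eq_zero.1 hτ)
  rw [integral_mul_deriv_off_countable hab zero_subsingleton.countable
    (continuousOn_mulLog_sub_mul him) (v := fun τ ↦ (Q τ : ℂ)) (by fun_prop)
    (fun τ hτ ↦ hasDerivAt_mulLog_sub_mul him hτ.1 hτ.2) (fun τ _ ↦ (hQ τ).ofReal_comp)
    log_int (Continuous.intervalIntegrable (by fun_prop) _ _)]
  simp only [mul_assoc, intervalIntegral.integral_const_mul]
  ring

lemma integral_mulLogMinus_mul_of_im_nonpos (hc : c ≠ 0) (hab : a ≤ b)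
    (him : ∀ τ ∈ Icc a b, (ζ - c * τ).im ≤ 0) {P Q : ℝ → ℝ} (hP : Continuous P)
    (hQ : ∀ τ, HasDerivAt Q (P τ) τ) :
    ∫ τ in a..b, mulLogMinus (ζ - c * τ) * (P τ : ℂ) =
      mulLogMinus (ζ - c * b) * Q b - mulLogMinus (ζ - c * a) * Q a
        + c * ∫ τ in a..b, (logMinus (ζ - c * τ) + 1) * (Q τ : ℂ) := by
  have reflected := congrArg conj (integral_mulLog_mul_of_im_nonneg (ζ := conj ζ) (c := conj c)
    (by simpa using hc) hab (fun τ hτ ↦ by simpa using him τ hτ) hP hQ)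
  simpa [← intervalIntegral.intervalIntegral_conj, mulLogMinus_eq_conj_mulLog_conj,
    logMinus_eq_conj_log_conj] using reflected

end Segment

lemma integral_mulLog_mul_of_im_eq_zero (z : ℂ) {c : ℂ} (hc : c ≠ 0) (hc_im : c.im = 0) {a b : ℝ}
    (hab : a ≤ b) {P Q : ℝ → ℝ} (hP : Continuous P) (hQ : ∀ τ, HasDerivAt Q (P τ) τ) :
    ∫ τ in a..b, mulLog (z - c * τ) * (P τ : ℂ) =
      mulLog (z - c * b) * Q b - mulLog (z - c * a) * Q a
        + c * ∫ τ in a..b, (log (z - c * τ) + 1) * (Q τ : ℂ) := by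
  have im_eq (τ : ℝ) : (z - c * τ).im = z.im := by simp [hc_im]
  rcases le_or_gt 0 z.im with him | him
  · exact integral_mulLog_mul_of_im_nonneg hc hab (fun τ _ ↦ him.trans_eq (im_eq τ).symm) hP hQ
  · have im_ne_zero (τ : ℝ) : (z - c * τ).im ≠ 0 := im_eq τ ▸ him.ne
    simpa only [mulLogMinus_of_im_ne_zero (im_ne_zero _), logMinus_of_im_ne_zero (im_ne_zero _)]
      using integral_mulLogMinus_mul_of_im_nonpos hc hab (fun τ _ ↦ (im_eq τ).trans_le him.le) hP hQ

lemma integral_mulLog_sub_I_mul_of_im_le {z : ℂ} {a b : ℝ} (hab : a ≤ b) (hza : z.im ≤ a)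
    (hzb : z.im < b) {P Q : ℝ → ℝ} (hP : Continuous P) (hQ : ∀ τ, HasDerivAt Q (P τ) τ) :
    ∫ τ in a..b, mulLog (z - I * τ) * (P τ : ℂ) =
      mulLog (z - I * b) * Q b - mulLogMinus (z - I * a) * Q a
        + I * ∫ τ in a..b, (log (z - I * τ) + 1) * (Q τ : ℂ) := by
  have im_ne_zero : ∀ τ : ℝ, z.im < τ → (z - I * τ).im ≠ 0 := fun τ hτ ↦ by
    simpa using sub_ne_zero.2 hτ.ne
  have lower := integral_mulLogMinus_mul_of_im_nonpos (ζ := z) I_ne_zero hab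
    (fun τ hτ ↦ by simpa using hza.trans hτ.1) hP hQ
  have mulLog_integral : ∫ τ in a..b, mulLogMinus (z - I * τ) * (P τ : ℂ) =
      ∫ τ in a..b, mulLog (z - I * τ) * (P τ : ℂ) :=
    intervalIntegral.integral_congr_Ioo_of_le hab fun τ hτ ↦ by
      simp only [mulLogMinus_of_im_ne_zero (im_ne_zero τ (hza.trans_lt hτ.1))]
  have log_integral : ∫ τ in a..b, (logMinus (z - I * τ) + 1) * (Q τ : ℂ) =
      ∫ τ in a..b, (log (z - I * τ) + 1) * (Q τ : ℂ) :=
    intervalIntegral.integral_congr_Ioo_of_le hab fun τ hτ ↦ by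
      simp only [logMinus_of_im_ne_zero (im_ne_zero τ (hza.trans_lt hτ.1))]
  rwa [mulLog_integral, log_integral, mulLogMinus_of_im_ne_zero (im_ne_zero b hzb)] at lower

/-- The last term is the jump of `w log w` across the branch cut, which the segment meets at height
`z.im`. -/
lemma integral_mulLog_sub_I_mul (z : ℂ) {a b : ℝ} (hab : a ≤ b) {P Q : ℝ → ℝ}
    (hP : Continuous P) (hQ : ∀ τ, HasDerivAt Q (P τ) τ) :
    ∫ τ in a..b, mulLog (z - I * τ) * (P τ : ℂ) =
      mulLog (z - I * b) * Q b - mulLog (z - I * a) * Q a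
        + I * (∫ τ in a..b, (log (z - I * τ) + 1) * (Q τ : ℂ))
        - 2 * I * Real.pi * Q z.im * (if a ≤ z.im ∧ z.im < b then max (-z.re) 0 else 0 : ℝ) := by
  rcases le_or_gt b z.im with hb | hb
  · rw [integral_mulLog_mul_of_im_nonneg I_ne_zero hab
      (fun τ hτ ↦ by simpa using hτ.2.trans hb) hP hQ, if_neg (by simp [hb])]
    simp
  rcases lt_or_ge z.im a with ha | ha
  · rw [integral_mulLog_sub_I_mul_of_im_le hab ha.le hb hP hQ,
      mulLogMinus_of_im_ne_zero (by simpa using sub_ne_zero.2 ha.ne), if_neg (by simp [ha])]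
    simp
  have hQ_cont : Continuous Q := continuous_iff_continuousAt.2 fun τ ↦ (hQ τ).continuousAt
  have log_int : ∀ a b : ℝ, IntervalIntegrable (fun τ : ℝ ↦ log (z - I * τ)) volume a b :=
    intervalIntegrable_log_sub_mul z I
  have left_int : ∀ a b : ℝ, IntervalIntegrable (fun τ : ℝ ↦ mulLog (z - I * τ) * (P τ : ℂ))
      volume a b := fun a b ↦
    ((log_int a b).continuousOn_mul (by fun_prop)).mul_continuousOn (by fun_prop)
  have right_int : ∀ a b : ℝ, IntervalIntegrable (fun τ : ℝ ↦ (log (z - I * τ) + 1) * (Q τ : ℂ))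
      volume a b := fun a b ↦
    ((log_int a b).add intervalIntegrable_const).mul_continuousOn (by fun_prop)
  have crossing_im : (z - I * z.im).im = 0 := by simp
  have crossing_re : (z - I * z.im).re = z.re := by simp
  rw [← intervalIntegral.integral_add_adjacent_intervals (left_int a z.im) (left_int z.im b),
    ← intervalIntegral.integral_add_adjacent_intervals (right_int a z.im) (right_int z.im b),
    integral_mulLog_mul_of_im_nonneg I_ne_zero ha (fun τ hτ ↦ by simpa using hτ.2) hP hQ,
    integral_mulLog_sub_I_mul_of_im_le hb.le le_rfl hb hP hQ, mulLogMinus_of_im_eq_zero crossing_im,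
    crossing_re, if_pos ⟨ha, hb⟩]
  ring

/-! ### Moments of the logarithm against Legendre polynomials -/

/-- The moment `∫_{-1}^1 f(z - e t) P_k(t) dt` of `f` along the segment of direction `e` centred at
`z`. With `f = log` it is `L_k(z)` for `e = 1` and `M_k(z)` for `e = i`. -/
noncomputable def legendreMoment (f : ℂ → ℂ) (e : ℂ) (k : ℤ) (z : ℂ) : ℂ :=
  ∫ t in (-1 : ℝ)..1, f (z - e * t) * (legendreP k t : ℂ)

/-- The integral defining `legendreMoment f e k z` converges absolutely. -/
def LegendreIntegrable (f : ℂ → ℂ) (e : ℂ) (k : ℤ) (z : ℂ) : Prop :=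
  IntervalIntegrable (fun t : ℝ ↦ f (z - e * t) * (legendreP k t : ℂ)) volume (-1) 1

section Linearity

variable {f g : ℂ → ℂ} {e : ℂ} {k : ℤ} {z : ℂ}

lemma LegendreIntegrable.add (hf : LegendreIntegrable f e k z) (hg : LegendreIntegrable g e k z) :
    LegendreIntegrable (fun w ↦ f w + g w) e k z := by
  simpa only [LegendreIntegrable, add_mul] using IntervalIntegrable.add hf hg

lemma LegendreIntegrable.const_mul_sub (c : ℂ) (hf : LegendreIntegrable f e k z)
    (hg : LegendreIntegrable g e k z) : LegendreIntegrable (fun w ↦ c * (f w - g w)) e k z := by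
  simpa only [LegendreIntegrable, mul_assoc, sub_mul] using
    (IntervalIntegrable.sub hf hg).const_mul c

lemma legendreMoment_add (hf : LegendreIntegrable f e k z) (hg : LegendreIntegrable g e k z) :
    legendreMoment (fun w ↦ f w + g w) e k z = legendreMoment f e k z + legendreMoment g e k z := by
  simp only [legendreMoment, add_mul]
  exact intervalIntegral.integral_add hf hg

lemma legendreMoment_const_mul_sub (c : ℂ) (hf : LegendreIntegrable f e k z)
    (hg : LegendreIntegrable g e k z) :
    legendreMoment (fun w ↦ c * (f w - g w)) e k z =
      c * (legendreMoment f e k z - legendreMoment g e k z) := by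
  simp only [legendreMoment, mul_assoc, sub_mul, intervalIntegral.integral_const_mul]
  rw [intervalIntegral.integral_sub hf hg]

lemma legendreIntegrable_comp_add {d : ℂ} :
    LegendreIntegrable (fun w ↦ f (w + d)) e k z ↔ LegendreIntegrable f e k (z + d) := by
  simp only [LegendreIntegrable, sub_add_eq_add_sub]

lemma legendreMoment_comp_add {d : ℂ} :
    legendreMoment (fun w ↦ f (w + d)) e k z = legendreMoment f e k (z + d) := by
  simp only [legendreMoment, sub_add_eq_add_sub]

lemma legendreIntegrable_of_continuous (hf : Continuous fun t : ℝ ↦ f (z - e * t)) :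
    LegendreIntegrable f e k z :=
  (hf.mul (by fun_prop)).intervalIntegrable _ _

end Linearity

lemma legendreMoment_const (c e : ℂ) (k : ℕ) (z : ℂ) :
    legendreMoment (fun _ ↦ c) e k z = if k = 0 then 2 * c else 0 := by
  rw [legendreMoment, intervalIntegral.integral_const_mul, intervalIntegral.integral_ofReal,
    integral_legendreP]
  split_ifs
  · push_cast
    ring
  · simp

lemma legendreIntegrable_log (e : ℂ) (k : ℤ) (z : ℂ) : LegendreIntegrable log e k z :=
  (intervalIntegrable_log_sub_mul z e (-1) 1).mul_continuousOn (by fun_prop)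

lemma legendreIntegrable_mulLog (e : ℂ) (k : ℤ) (z : ℂ) : LegendreIntegrable mulLog e k z :=
  ((intervalIntegrable_log_sub_mul z e (-1) 1).continuousOn_mul (by fun_prop)).mul_continuousOn
    (by fun_prop)

lemma intervalIntegrable_logKernel (k : ℤ) (z : ℂ) :
    IntervalIntegrable (logKernel k z) volume (-1) 1 := by
  simpa only [LegendreIntegrable, one_mul] using! legendreIntegrable_log 1 k z

lemma intervalIntegrable_logKernelI (k : ℤ) (z : ℂ) :
    IntervalIntegrable (logKernelI k z) volume (-1) 1 :=
  legendreIntegrable_log I k z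

lemma logL_eq_legendreMoment (k : ℤ) (z : ℂ) : logL k z = legendreMoment log 1 k z := by
  simp only [logL, logKernel, legendreMoment, one_mul]

lemma logM_eq_legendreMoment (k : ℤ) (z : ℂ) : logM k z = legendreMoment log I k z := rfl

lemma integral_log_add_one_mul_legendrePrimitive (e : ℂ) (k : ℕ) (z : ℂ) :
    ∫ t in (-1 : ℝ)..1, (log (z - e * t) + 1) * (legendrePrimitive k t : ℂ) =
      1 / (2 * k + 1)
        * (legendreMoment log e ((k : ℤ) + 1) z - legendreMoment log e ((k : ℤ) - 1) z)
        + if k = 1 then -2 / 3 else 0 := by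
  have log_int := fun j : ℤ ↦ legendreIntegrable_log e j z
  have primitive_integral :
      ∫ t in (-1 : ℝ)..1, (legendrePrimitive k t : ℂ) = if k = 1 then -2 / 3 else 0 := by
    rw [intervalIntegral.integral_ofReal, integral_legendrePrimitive]
    split_ifs <;> norm_num
  rw [← primitive_integral, legendreMoment, legendreMoment,
    ← intervalIntegral.integral_sub (log_int _) (log_int _), ← intervalIntegral.integral_const_mul,
    ← intervalIntegral.integral_add (((log_int _).sub (log_int _)).const_mul _)
      (Continuous.intervalIntegrable (by fun_prop) _ _)]
  refine intervalIntegral.integral_congr fun t _ ↦ ?_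
  simp only [legendrePrimitive_eq_sub]
  push_cast
  ring

/-- The explicit terms that the endpoints of the segment of direction `e` contribute when
`w log w` is integrated by parts against `P_k`; for `e = 1` they make up `λ_k`. -/
noncomputable def endpointTerm (e : ℂ) (k : ℕ) (z : ℂ) : ℂ :=
  if k = 0 then mulLog (z - e) + mulLog (z + e) else if k = 1 then -2 * e / 3 else 0

lemma lambdaTerm_eq_endpointTerm (k : ℕ) (z : ℂ) : lambdaTerm k z = endpointTerm 1 k z := by
  simp only [lambdaTerm, endpointTerm, mulLog, mul_one]

lemma endpointTerm_eq (e : ℂ) (k : ℕ) (z : ℂ) :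
    endpointTerm e k z = mulLog (z - e * (1 : ℝ)) * legendrePrimitive k 1
      - mulLog (z - e * (-1 : ℝ)) * legendrePrimitive k (-1) + e * if k = 1 then -2 / 3 else 0 := by
  rw [endpointTerm, legendrePrimitive_one, legendrePrimitive_neg_one]
  rcases k with _ | _ | k <;> simp
  ring

lemma legendreMoment_mulLog_one (k : ℕ) (z : ℂ) :
    legendreMoment mulLog 1 k z =
      1 / (2 * k + 1)
        * (legendreMoment log 1 ((k : ℤ) + 1) z - legendreMoment log 1 ((k : ℤ) - 1) z)
        + endpointTerm 1 k z := by
  rw [legendreMoment, integral_mulLog_mul_of_im_eq_zero z one_ne_zero one_im (by norm_num)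
    (continuous_legendreP k) (hasDerivAt_legendrePrimitive k),
    integral_log_add_one_mul_legendrePrimitive, endpointTerm_eq]
  ring

/-- The contribution of the branch cut to the integration by parts along the vertical segment
centred at `z`, namely the jump of `w log w` times the antiderivative of `P_k`, taken at the point
where the segment meets the negative real axis. It is part of `μ_k`. -/
noncomputable def jumpTerm (k : ℕ) (z : ℂ) : ℂ :=
  -2 * I * Real.pi * legendrePrimitive k z.im
    * (if -1 ≤ z.im ∧ z.im < 1 then max (-z.re) 0 else 0 : ℝ)

lemma legendreMoment_mulLog_I (k : ℕ) (z : ℂ) :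
    legendreMoment mulLog I k z =
      I / (2 * k + 1)
        * (legendreMoment log I ((k : ℤ) + 1) z - legendreMoment log I ((k : ℤ) - 1) z)
        + (endpointTerm I k z + jumpTerm k z) := by
  rw [legendreMoment, integral_mulLog_sub_I_mul z (by norm_num) (continuous_legendreP k)
    (hasDerivAt_legendrePrimitive k), integral_log_add_one_mul_legendrePrimitive, endpointTerm_eq,
    jumpTerm]
  ring

lemma muTerm_eq_endpointTerm_add_jumpTerm (k : ℕ) (z : ℂ) :
    muTerm k z = endpointTerm I k z + jumpTerm k z := by
  rw [muTerm, ← mulLogMinus, ← mulLog, endpointTerm, jumpTerm]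
  rcases eq_or_ne z.im (-1) with him | him
  · rw [mulLogMinus_of_im_eq_zero (by simp [him]), him, legendrePrimitive_neg_one]
    rcases k with _ | _ | k <;> simp
    ring
  · have cut_iff : -1 ≤ z.im ∧ z.im < 1 ↔ -1 < z.im ∧ z.im < 1 :=
      and_congr_left' ⟨fun h ↦ h.lt_of_ne' him, le_of_lt⟩
    rw [mulLogMinus_of_im_ne_zero (by simpa [add_eq_zero_iff_eq_neg] using him),
      mul_div_right_comm, legendrePrimitive]
    simp only [cut_iff]
    rcases lt_or_ge z.re 0 with hre | hre
    · simp only [hre, true_and, max_eq_left (neg_nonneg.2 hre.le)]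
      split_ifs <;> push_cast <;> ring
    · simp only [hre.not_gt, false_and, if_false, max_eq_right (neg_nonpos.2 hre)]
      simp

/-! ### Integration over the square -/

section Fubini

variable {E : Type*} [NormedAddCommGroup E] {g : ℝ × ℝ → E}

lemma integrableOn_square_iff : IntegrableOn g square ↔
    Integrable g ((volume.restrict (Icc (-1 : ℝ) 1)).prod (volume.restrict (Icc (-1 : ℝ) 1))) := by
  rw [Measure.prod_restrict, ← Measure.volume_eq_prod]
  rfl

variable [NormedSpace ℝ E]

lemma intervalIntegral_eq_setIntegral_Icc (f : ℝ → E) :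
    ∫ t in (-1 : ℝ)..1, f t = ∫ t in Icc (-1 : ℝ) 1, f t := by
  rw [intervalIntegral.integral_of_le (by norm_num), integral_Icc_eq_integral_Ioc]

lemma setIntegral_square_eq (hg : IntegrableOn g square) :
    ∫ p in square, g p = ∫ s in (-1 : ℝ)..1, ∫ t in (-1 : ℝ)..1, g (s, t) := by
  simp only [intervalIntegral_eq_setIntegral_Icc]
  exact setIntegral_prod g hg

lemma setIntegral_square_eq_symm (hg : IntegrableOn g square) :
    ∫ p in square, g p = ∫ t in (-1 : ℝ)..1, ∫ s in (-1 : ℝ)..1, g (s, t) :=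
  (setIntegral_prod_swap (Icc (-1) 1) (Icc (-1) 1) g).symm.trans
    (setIntegral_square_eq (IntegrableOn.swap hg))

lemma intervalIntegrable_integral_snd (hg : IntegrableOn g square) :
    IntervalIntegrable (fun s ↦ ∫ t in (-1 : ℝ)..1, g (s, t)) volume (-1) 1 := by
  simp only [intervalIntegral_eq_setIntegral_Icc]
  exact (intervalIntegrable_iff_integrableOn_Icc_of_le (by norm_num)).2
    (integrableOn_square_iff.1 hg).integral_prod_left

lemma intervalIntegrable_integral_fst (hg : IntegrableOn g square) :
    IntervalIntegrable (fun t ↦ ∫ s in (-1 : ℝ)..1, g (s, t)) volume (-1) 1 :=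
  intervalIntegrable_integral_snd (IntegrableOn.swap hg)

end Fubini

lemma isCompact_square : IsCompact square := isCompact_Icc.prod isCompact_Icc

/-! ### Moments over the square -/

/-- The moment `∬_Ω f(z - (s + i t)) P_k(s) P_j(t) ds dt` of `f` over the square centred at `z`.
With `f = log` it is `L_{kj}(z)`. -/
noncomputable def legendreMoment₂ (f : ℂ → ℂ) (k j : ℤ) (z : ℂ) : ℂ :=
  ∫ p in square, f (z - (p.1 + I * p.2)) * ((legendreP k p.1 * legendreP j p.2 : ℝ) : ℂ)

lemma logL₂_eq_legendreMoment₂ (k j : ℤ) (z : ℂ) : logL₂ k j z = legendreMoment₂ log k j z := rfl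

section IteratedMoments

variable {f : ℂ → ℂ} {k j : ℤ} {z : ℂ}

lemma integrableOn_mul_legendreP_mul_legendreP
    (hf : IntegrableOn (fun p : ℝ × ℝ ↦ f (z - (p.1 + I * p.2))) square) :
    IntegrableOn (fun p : ℝ × ℝ ↦
      f (z - (p.1 + I * p.2)) * ((legendreP k p.1 * legendreP j p.2 : ℝ) : ℂ)) square :=
  hf.mul_continuousOn (by fun_prop) isCompact_square

lemma integral_fst_eq_legendreMoment_mul (t : ℝ) :
    ∫ s in (-1 : ℝ)..1, f (z - (s + I * t)) * ((legendreP k s * legendreP j t : ℝ) : ℂ) =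
      legendreMoment f 1 k (z - I * t) * legendreP j t := by
  rw [legendreMoment, ← intervalIntegral.integral_mul_const]
  congr! 2
  rw [one_mul, sub_sub, add_comm (I * (t : ℂ)), ofReal_mul, mul_assoc]

lemma integral_snd_eq_legendreMoment_mul (s : ℝ) :
    ∫ t in (-1 : ℝ)..1, f (z - (s + I * t)) * ((legendreP k s * legendreP j t : ℝ) : ℂ) =
      legendreMoment f I j (z - 1 * s) * legendreP k s := by
  rw [legendreMoment, ← intervalIntegral.integral_mul_const]
  congr! 2
  rw [one_mul, sub_sub, mul_comm (legendreP k s), ofReal_mul, mul_assoc]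

lemma legendreMoment₂_eq_legendreMoment_I
    (hf : IntegrableOn (fun p : ℝ × ℝ ↦ f (z - (p.1 + I * p.2))) square) :
    legendreMoment₂ f k j z = legendreMoment (legendreMoment f 1 k) I j z := by
  rw [legendreMoment₂, setIntegral_square_eq_symm (integrableOn_mul_legendreP_mul_legendreP hf)]
  simp only [integral_fst_eq_legendreMoment_mul]
  rfl

lemma legendreMoment₂_eq_legendreMoment_one
    (hf : IntegrableOn (fun p : ℝ × ℝ ↦ f (z - (p.1 + I * p.2))) square) :
    legendreMoment₂ f k j z = legendreMoment (legendreMoment f I j) 1 k z := by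
  rw [legendreMoment₂, setIntegral_square_eq (integrableOn_mul_legendreP_mul_legendreP hf)]
  simp only [integral_snd_eq_legendreMoment_mul]
  rfl

lemma legendreIntegrable_legendreMoment_one
    (hf : IntegrableOn (fun p : ℝ × ℝ ↦ f (z - (p.1 + I * p.2))) square) :
    LegendreIntegrable (legendreMoment f 1 k) I j z := by
  simpa only [LegendreIntegrable, integral_fst_eq_legendreMoment_mul] using
    intervalIntegrable_integral_fst (integrableOn_mul_legendreP_mul_legendreP (k := k) (j := j) hf)

lemma legendreIntegrable_legendreMoment_I
    (hf : IntegrableOn (fun p : ℝ × ℝ ↦ f (z - (p.1 + I * p.2))) square) :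
    LegendreIntegrable (legendreMoment f I j) 1 k z := by
  simpa only [LegendreIntegrable, integral_snd_eq_legendreMoment_mul] using
    intervalIntegrable_integral_snd (integrableOn_mul_legendreP_mul_legendreP (k := k) (j := j) hf)

end IteratedMoments

lemma norm_log_le_norm_add_abs_log_im_add_pi {w : ℂ} (hw : w.im ≠ 0) :
    ‖log w‖ ≤ ‖w‖ + |Real.log w.im| + Real.pi := by
  have norm_pos : 0 < ‖w‖ := norm_pos_iff.2 fun h ↦ hw (by rw [h, zero_im])
  have upper : Real.log ‖w‖ ≤ ‖w‖ - 1 := Real.log_le_sub_one_of_pos norm_pos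
  have lower : Real.log w.im ≤ Real.log ‖w‖ := by
    rw [← Real.log_abs]
    exact Real.log_le_log (abs_pos.2 hw) (abs_im_le_norm w)
  have log_norm_le : |Real.log ‖w‖| ≤ ‖w‖ + |Real.log w.im| :=
    abs_le.2 ⟨by linarith [neg_abs_le (Real.log w.im)], by linarith [abs_nonneg (Real.log w.im)]⟩
  linarith [norm_log_le_abs_log_norm_add_pi w]

lemma integrableOn_log_square (z : ℂ) :
    IntegrableOn (fun p : ℝ × ℝ ↦ log (z - (p.1 + I * p.2))) square := by
  have log_im : IntegrableOn (fun t : ℝ ↦ Real.log (z.im - t)) (Icc (-1) 1) := by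
    rw [← intervalIntegrable_iff_integrableOn_Icc_of_le (by norm_num)]
    simpa using (intervalIntegral.intervalIntegrable_log'
      (a := z.im + 1) (b := z.im - 1)).comp_sub_left z.im
  have log_im₂ : IntegrableOn (fun p : ℝ × ℝ ↦ Real.log (z.im - p.2)) square :=
    integrableOn_square_iff.2 (Integrable.comp_snd log_im _)
  have norm_integrable : IntegrableOn (fun p : ℝ × ℝ ↦ ‖z - (p.1 + I * p.2)‖) square :=
    ContinuousOn.integrableOn_compact isCompact_square (by fun_prop)
  have const_integrable : IntegrableOn (fun _ : ℝ × ℝ ↦ Real.pi) square :=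
    continuousOn_const.integrableOn_compact isCompact_square
  have log_meas : Measurable fun p : ℝ × ℝ ↦ log (z - (p.1 + I * p.2)) := by fun_prop
  refine ((norm_integrable.add log_im₂.abs).add const_integrable).mono'
    log_meas.aestronglyMeasurable (ae_restrict_of_ae ?_)
  have im_ne : ∀ᵐ p : ℝ × ℝ, p.2 ≠ z.im :=
    Measure.quasiMeasurePreserving_snd.ae (Measure.ae_ne volume z.im)
  filter_upwards [im_ne] with p hp
  have hw : (z - (p.1 + I * p.2)).im = z.im - p.2 := by simp
  rw [Pi.add_apply, Pi.add_apply, ← hw]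
  exact norm_log_le_norm_add_abs_log_im_add_pi (by simpa [hw, sub_eq_zero] using hp.symm)

lemma integrableOn_mulLog_square (z : ℂ) :
    IntegrableOn (fun p : ℝ × ℝ ↦ mulLog (z - (p.1 + I * p.2))) square :=
  (integrableOn_log_square z).continuousOn_mul (by fun_prop) isCompact_square

lemma integrableOn_logKernel₂ (k j : ℤ) (z : ℂ) : IntegrableOn (logKernel₂ k j z) square :=
  integrableOn_mul_legendreP_mul_legendreP (integrableOn_log_square z)

lemma mul_logKernel₂ (k j : ℕ) (z : ℂ) (p : ℝ × ℝ) :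
    z * logKernel₂ k j z p =
      mulLog (z - (p.1 + I * p.2)) * ((legendreP k p.1 * legendreP j p.2 : ℝ) : ℂ)
        + ((k : ℂ) / (2 * k + 1) * logKernel₂ ((k : ℤ) - 1) j z p
          + ((k : ℂ) + 1) / (2 * k + 1) * logKernel₂ ((k : ℤ) + 1) j z p)
        + I * ((j : ℂ) / (2 * j + 1) * logKernel₂ k ((j : ℤ) - 1) z p
          + ((j : ℂ) + 1) / (2 * j + 1) * logKernel₂ k ((j : ℤ) + 1) z p) := by
  have recurrence_fst := congrArg (fun r : ℝ ↦ (r : ℂ)) (mul_legendreP k p.1)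
  have recurrence_snd := congrArg (fun r : ℝ ↦ (r : ℂ)) (mul_legendreP j p.2)
  simp only [logKernel₂, mulLog] at recurrence_fst recurrence_snd ⊢
  push_cast at recurrence_fst recurrence_snd ⊢
  linear_combination log (z - (p.1 + I * p.2)) * legendreP j p.2 * recurrence_fst
    + I * log (z - (p.1 + I * p.2)) * legendreP k p.1 * recurrence_snd

lemma mul_logL₂ (k j : ℕ) (z : ℂ) :
    z * logL₂ k j z = legendreMoment₂ mulLog k j z
      + ((k : ℂ) / (2 * k + 1) * logL₂ ((k : ℤ) - 1) j z
        + ((k : ℂ) + 1) / (2 * k + 1) * logL₂ ((k : ℤ) + 1) j z)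
      + I * ((j : ℂ) / (2 * j + 1) * logL₂ k ((j : ℤ) - 1) z
        + ((j : ℂ) + 1) / (2 * j + 1) * logL₂ k ((j : ℤ) + 1) z) := by
  have log_int (k j : ℤ) : Integrable (logKernel₂ k j z) (volume.restrict square) :=
    integrableOn_logKernel₂ k j z
  have mulLog_int : Integrable (fun p : ℝ × ℝ ↦ mulLog (z - (p.1 + I * p.2))
      * ((legendreP k p.1 * legendreP j p.2 : ℝ) : ℂ)) (volume.restrict square) :=
    integrableOn_mul_legendreP_mul_legendreP (integrableOn_mulLog_square z)
  simp only [logL₂]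
  rw [← integral_const_mul]
  simp only [mul_logKernel₂]
  rw [integral_add, integral_add, integral_add, integral_const_mul I, integral_add]
  · simp only [integral_const_mul, legendreMoment₂]
  all_goals fun_prop

/-! ### The two recurrences -/

section EndpointMoment

variable (d e : ℂ) (k : ℕ) (z : ℂ)

lemma endpointTerm_zero :
    endpointTerm d 0 = fun w ↦ mulLog (w + -d) + mulLog (w + d) := by
  funext w
  rw [endpointTerm, if_pos rfl, sub_eq_add_neg]

lemma endpointTerm_one : endpointTerm d 1 = fun _ ↦ -2 * d / 3 := rfl

lemma endpointTerm_add_two : endpointTerm d (k + 2) = fun _ ↦ 0 := rfl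

lemma legendreIntegrable_endpointTerm (j : ℤ) : LegendreIntegrable (endpointTerm d k) e j z := by
  match k with
  | 0 =>
    rw [endpointTerm_zero]
    exact (legendreIntegrable_comp_add.2 (legendreIntegrable_mulLog e j _)).add
      (legendreIntegrable_comp_add.2 (legendreIntegrable_mulLog e j _))
  | 1 => exact legendreIntegrable_of_continuous continuous_const
  | k + 2 => exact legendreIntegrable_of_continuous continuous_const

lemma legendreMoment_endpointTerm (j : ℕ) :
    legendreMoment (endpointTerm d k) e j z =
      if k = 0 then legendreMoment mulLog e j (z - d) + legendreMoment mulLog e j (z + d)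
      else if k = 1 ∧ j = 0 then -4 * d / 3 else 0 := by
  match k with
  | 0 =>
    rw [endpointTerm_zero, legendreMoment_add
      (legendreIntegrable_comp_add.2 (legendreIntegrable_mulLog e j _))
      (legendreIntegrable_comp_add.2 (legendreIntegrable_mulLog e j _)), legendreMoment_comp_add,
      legendreMoment_comp_add, if_pos rfl, sub_eq_add_neg]
  | 1 =>
    rw [endpointTerm_one, legendreMoment_const]
    simp only [one_ne_zero, if_false, true_and]
    split_ifs <;> ring
  | k + 2 =>
    rw [endpointTerm_add_two, legendreMoment_const]
    simp

end EndpointMoment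

lemma inhomOne_eq_legendreMoment (k j : ℕ) (z : ℂ) :
    inhomOne k j z = legendreMoment (endpointTerm 1 k) I j z := by
  rw [legendreMoment_endpointTerm, inhomOne, legendreMoment_mulLog_I, legendreMoment_mulLog_I]
  simp only [muTerm_eq_endpointTerm_add_jumpTerm, logM_eq_legendreMoment]
  split_ifs <;> ring

lemma integral_max_sub_zero_mul_legendreP (k : ℕ) (x : ℝ) :
    ∫ s in (-1 : ℝ)..1, max (s - x) 0 * legendreP k s =
      if x < -1 then (if k = 0 then -2 * x else 0) + (if k = 1 then 2 / 3 else 0)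
      else if x ≤ 1 then ultraspherical (-3 / 2) (k + 2) x / 3 - (if k = 0 then x else 0)
        + (if k = 1 then 1 / 3 else 0)
      else 0 := by
  have integral_of_le {a b : ℝ} (hab : a ≤ b) (hxa : x ≤ a) :
      ∫ s in a..b, max (s - x) 0 * legendreP k s = ∫ s in a..b, (s - x) * legendreP k s := by
    refine intervalIntegral.integral_congr fun s hs ↦ ?_
    rw [uIcc_of_le hab] at hs
    simp only [max_eq_left (sub_nonneg.2 (hxa.trans hs.1))]
  have integral_of_ge {a b : ℝ} (hab : a ≤ b) (hbx : b ≤ x) :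
      ∫ s in a..b, max (s - x) 0 * legendreP k s = 0 := by
    refine intervalIntegral.integral_zero_ae (.of_forall fun s hs ↦ ?_)
    rw [uIoc_of_le hab] at hs
    rw [max_eq_right (sub_nonpos.2 (hs.2.trans hbx)), zero_mul]
  rcases lt_or_ge x (-1) with hx_left | hx_left
  · rw [if_pos hx_left, integral_of_le (by norm_num) hx_left.le,
      integral_sub_mul_legendreP_neg_one_one]
  rw [if_neg hx_left.not_gt]
  rcases le_or_gt x 1 with hx_right | hx_right
  · have integrable (a b : ℝ) :
        IntervalIntegrable (fun s ↦ max (s - x) 0 * legendreP k s) volume a b :=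
      Continuous.intervalIntegrable (by fun_prop) _ _
    rw [if_pos hx_right, ← intervalIntegral.integral_add_adjacent_intervals (integrable (-1) x)
      (integrable x 1), integral_of_ge hx_left le_rfl, integral_of_le hx_right le_rfl, zero_add,
      integral_sub_mul_legendreP_self_one]
  · rw [if_neg hx_right.not_ge, integral_of_ge (by norm_num) hx_right.le]

lemma betaFactor_eq_integral (k : ℕ) (z : ℂ) :
    betaFactor k z = if -1 ≤ z.im ∧ z.im < 1 then
      ∫ s in (-1 : ℝ)..1, max (s - z.re) 0 * legendreP k s else 0 := by
  rw [integral_max_sub_zero_mul_legendreP, betaFactor]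
  simp only [square, mem_prod, mem_Icc]
  grind

lemma betaTerm_eq_legendreMoment (k j : ℕ) (z : ℂ) :
    betaTerm k j z = legendreMoment (jumpTerm j) 1 k z := by
  rw [betaTerm, betaFactor_eq_integral, legendreMoment]
  simp only [jumpTerm, one_mul, sub_re, sub_im, ofReal_re, ofReal_im, sub_zero, neg_sub, mul_assoc,
    intervalIntegral.integral_const_mul, ← ofReal_mul, intervalIntegral.integral_ofReal, ite_mul,
    zero_mul, legendrePrimitive]
  split_ifs
  · push_cast
    ring
  · simp

lemma legendreIntegrable_jumpTerm (k : ℤ) (j : ℕ) (z : ℂ) :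
    LegendreIntegrable (jumpTerm j) 1 k z := by
  refine legendreIntegrable_of_continuous ?_
  simp only [jumpTerm, one_mul, sub_re, sub_im, ofReal_re, ofReal_im, sub_zero, neg_sub]
  split_ifs <;> fun_prop

lemma inhomTwo_eq_legendreMoment (k j : ℕ) (z : ℂ) :
    inhomTwo k j z = legendreMoment (fun w ↦ endpointTerm I j w + jumpTerm j w) 1 k z := by
  rw [legendreMoment_add (legendreIntegrable_endpointTerm I 1 j z k)
      (legendreIntegrable_jumpTerm k j z), ← betaTerm_eq_legendreMoment,
    legendreMoment_endpointTerm, inhomTwo, legendreMoment_mulLog_one, legendreMoment_mulLog_one]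
  simp only [lambdaTerm_eq_endpointTerm, logL_eq_legendreMoment]
  grind

lemma legendreMoment₂_mulLog_eq_add_inhomOne (k j : ℕ) (z : ℂ) :
    legendreMoment₂ mulLog k j z =
      1 / (2 * k + 1) * (logL₂ ((k : ℤ) + 1) j z - logL₂ ((k : ℤ) - 1) j z) + inhomOne k j z := by
  have hlog := integrableOn_log_square z
  have moments_integrable (i : ℤ) : LegendreIntegrable (legendreMoment log 1 i) I j z :=
    legendreIntegrable_legendreMoment_one hlog
  rw [legendreMoment₂_eq_legendreMoment_I (integrableOn_mulLog_square z),
    funext (legendreMoment_mulLog_one k),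
    legendreMoment_add ((moments_integrable _).const_mul_sub _ (moments_integrable _))
      (legendreIntegrable_endpointTerm 1 I k z j),
    legendreMoment_const_mul_sub _ (moments_integrable _) (moments_integrable _),
    inhomOne_eq_legendreMoment]
  simp only [logL₂_eq_legendreMoment₂, legendreMoment₂_eq_legendreMoment_I hlog]

lemma legendreMoment₂_mulLog_eq_add_inhomTwo (k j : ℕ) (z : ℂ) :
    legendreMoment₂ mulLog k j z =
      I / (2 * j + 1) * (logL₂ k ((j : ℤ) + 1) z - logL₂ k ((j : ℤ) - 1) z) + inhomTwo k j z := by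
  have hlog := integrableOn_log_square z
  have moments_integrable (i : ℤ) : LegendreIntegrable (legendreMoment log I i) 1 k z :=
    legendreIntegrable_legendreMoment_I hlog
  rw [legendreMoment₂_eq_legendreMoment_one (integrableOn_mulLog_square z),
    funext (legendreMoment_mulLog_I j),
    legendreMoment_add ((moments_integrable _).const_mul_sub _ (moments_integrable _))
      ((legendreIntegrable_endpointTerm I 1 j z k).add (legendreIntegrable_jumpTerm k j z)),
    legendreMoment_const_mul_sub _ (moments_integrable _) (moments_integrable _),
    inhomTwo_eq_legendreMoment]
  simp only [logL₂_eq_legendreMoment₂, legendreMoment₂_eq_legendreMoment_one hlog]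

end NewtonianLog

theorem mainTheorem3 (z : ℂ) :
    (∀ k : ℕ, IntervalIntegrable (NewtonianLog.logKernel k z) MeasureTheory.volume (-1) 1) ∧
    (∀ k : ℕ, IntervalIntegrable (NewtonianLog.logKernelI k z) MeasureTheory.volume (-1) 1) ∧
    ∀ k j : ℕ,
      MeasureTheory.IntegrableOn (NewtonianLog.logKernel₂ k j z) NewtonianLog.square ∧
      z * NewtonianLog.logL₂ k j z =
        ((k : ℂ) - 1) / (2 * k + 1) * NewtonianLog.logL₂ ((k : ℤ) - 1) j z
        + ((k : ℂ) + 2) / (2 * k + 1) * NewtonianLog.logL₂ ((k : ℤ) + 1) j z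
        + Complex.I * ((j : ℂ) / (2 * j + 1) * NewtonianLog.logL₂ k ((j : ℤ) - 1) z
          + ((j : ℂ) + 1) / (2 * j + 1) * NewtonianLog.logL₂ k ((j : ℤ) + 1) z)
        + NewtonianLog.inhomOne k j z ∧
      z * NewtonianLog.logL₂ k j z =
        (k : ℂ) / (2 * k + 1) * NewtonianLog.logL₂ ((k : ℤ) - 1) j z
        + ((k : ℂ) + 1) / (2 * k + 1) * NewtonianLog.logL₂ ((k : ℤ) + 1) j z
        + Complex.I * (((j : ℂ) - 1) / (2 * j + 1) * NewtonianLog.logL₂ k ((j : ℤ) - 1) z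
          + ((j : ℂ) + 2) / (2 * j + 1) * NewtonianLog.logL₂ k ((j : ℤ) + 1) z)
        + NewtonianLog.inhomTwo k j z := by
  refine ⟨fun k ↦ NewtonianLog.intervalIntegrable_logKernel k z,
    fun k ↦ NewtonianLog.intervalIntegrable_logKernelI k z,
    fun k j ↦ ⟨NewtonianLog.integrableOn_logKernel₂ k j z, ?_, ?_⟩⟩
  · rw [NewtonianLog.mul_logL₂, NewtonianLog.legendreMoment₂_mulLog_eq_add_inhomOne]
    ring
  · rw [NewtonianLog.mul_logL₂, NewtonianLog.legendreMoment₂_mulLog_eq_add_inhomTwo]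
    ring
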